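/- Let $n\ge 1$ and let $X_1,\dots,X_n$ be independent random variables taking values in $\{0,1,2\}$. Put $S_n=X_1+\cdots+X_n$, $J=S_n \bmod 2\in\{0,1\}$ and $K=(S_n-J)/2$. For a random variable $Y$ with values in a finite set of nonnegative integers let $H(Y)=-\sum_j \mathbb P(Y=j)\log_2\mathbb P(Y=j)$ (with $0\log_2 0=0$) denote its Shannon entropy in bits; for $\mathbb P(J=j)>0$ let $H(K\mid J=j)$ denote the entropy of the conditional law of $K$ given the event $J=j$, and let $H(K\mid J)=\sum_{j}\mathbb P(J=j)\,H(K\mid J=j)$, where the sum is over those $j\in\{0,1\}$ with $\mathbb P(J=j)>0$. Let $B_m\sim\operatorname{Bin}(m,1/2)$. Then $$H(K\mid J=0)\le H(B_n)\ \text{ if } \mathbb P(J=0)>0,\qquad H(K\mid J=1)\le H(B_{n-1})\ \text{ if } \mathbb P(J=1)>0,$$ and consequently $$H(K\mid J)\le \mathbb P(J=0)\,H(B_n)+\mathbb P(J=1)\,H(B_{n-1}).$$ -/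

import Mathlib

open MeasureTheory ProbabilityTheory

noncomputable section

/-- Shannon entropy in bits, `-∑ j, ν{j} * log₂ ν{j}`, of a probability law `ν` on `ℕ`
(a term with `ν{j} = 0` is `0`; for a finitely supported law this is a finite sum). -/
def lawEntropy (ν : Measure ℕ) : ℝ :=
  -∑' j : ℕ, ν.real {j} * Real.logb 2 (ν.real {j})

/-- `H(X)`: the Shannon entropy in bits of an `ℕ`-valued random variable `X` under `μ`. -/
def shannonEntropy {Ω : Type*} [MeasurableSpace Ω] (μ : Measure Ω) (X : Ω → ℕ) : ℝ :=
  lawEntropy (μ.map X)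

/-- `H(X ∣ Y = y)`: the entropy of `X` under the conditional probability measure `μ(· ∣ Y = y)`;
meaningful when the event `Y = y` has positive probability. -/
def entropyGivenEq {Ω : Type*} [MeasurableSpace Ω] (μ : Measure Ω) (X Y : Ω → ℕ) (y : ℕ) : ℝ :=
  shannonEntropy (ProbabilityTheory.cond μ (Y ⁻¹' {y})) X

/-- `H(X ∣ Y) = ∑ y, P(Y = y) * H(X ∣ Y = y)`: conditional Shannon entropy in bits. -/
def condShannonEntropy {Ω : Type*} [MeasurableSpace Ω] (μ : Measure Ω) (X Y : Ω → ℕ) : ℝ :=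
  ∑' y : ℕ, μ.real (Y ⁻¹' {y}) * entropyGivenEq μ X Y y

/-- `H(B_m)`, where `B_m` has the binomial law `Bin(m, 1/2)`. -/
def binomialHalfEntropy (m : ℕ) : ℝ :=
  lawEntropy (ProbabilityTheory.binomial m ⟨1 / 2, by norm_num, by norm_num⟩)

/-- `S = X₁ + ⋯ + Xₙ`. -/
def sumVar {Ω : Type*} {n : ℕ} (X : Fin n → Ω → ℕ) : Ω → ℕ :=
  fun ω => ∑ i, X i ω

/-- The parity `J = S mod 2` of the sum. -/
def parityVar {Ω : Type*} {n : ℕ} (X : Fin n → Ω → ℕ) : Ω → ℕ :=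
  fun ω => sumVar X ω % 2

/-- `K = (S - J) / 2`; subtraction and division are exact because `J = S mod 2`. -/
def halfVar {Ω : Type*} {n : ℕ} (X : Fin n → Ω → ℕ) : Ω → ℕ :=
  fun ω => (sumVar X ω - parityVar X ω) / 2

end

/-! The generating function `f` of `S` is a product of quadratics with nonnegative coefficients, so
for `Re z > 0` it does not vanish and `|f(-z)| ≤ |f(z)|`, strictly unless `f` is even or odd. Write
`f(z) = E(z²) + z O(z²)`. A root of `E` or `O` off the nonpositive real axis is some `z²` with `Re z
> 0`, and there `f(-z) = -f(z)` or `f(-z) = f(z)` respectively, which is impossible unless that part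
is zero (`root_contract_nonpos`, `root_contract_divX_nonpos`). A polynomial with only nonpositive
real roots splits into multiples of factors `(1 - p) + p X` (`exists_eq_poissonBinomialPoly`).
Hence, given `J`, `K` is distributed as a sum of independent Bernoulli variables: `n` of them if `J
= 0`, `n - 1` if `J = 1`.

Such a sum of `n` variables has entropy at most that of `Bin(n, 1/2)`
(`coeffEntropy_poissonBinomialPoly_le`). Let `m` be the average parameter. Gibbs' inequality against
`Bin(n, m)` bounds the entropy by `n h(m) - E log C(n, ·)`. As `log C(n, k)` is concave in `k`,
Hoeffding's comparison (`coeffSum_pow_mul_le`) allows the expectation to be taken under `Bin(n, m)`,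
which gives the entropy of `Bin(n, m)`. That is concave in `m` and symmetric about `1/2`, so it is
largest there. -/

/-! ### Poisson-binomial generating functions and Hoeffding's comparison. -/

section PoissonBinomial

open Polynomial Finset

/-- The linear functional `∑ aₖ Xᵏ ↦ ∑ f k * aₖ`; on a probability generating function it is the
expectation of `f`. -/
noncomputable def coeffSum (f : ℕ → ℝ) : ℝ[X] →ₗ[ℝ] ℝ :=
  Polynomial.lsum fun k => f k • LinearMap.id

lemma coeffSum_eq_sum (f : ℕ → ℝ) {P : ℝ[X]} {N : ℕ} (h : P.natDegree < N) :
    coeffSum f P = ∑ k ∈ range N, f k * P.coeff k := by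
  have : coeffSum f P = P.sum fun k a => f k * a := rfl
  rw [this, Polynomial.sum_over_range' _ (by simp) N h]

lemma coeffSum_monomial (f : ℕ → ℝ) (k : ℕ) (a : ℝ) : coeffSum f (monomial k a) = f k * a := by
  have : coeffSum f (monomial k a) = (monomial k a).sum fun k a => f k * a := rfl
  rw [this, Polynomial.sum_monomial_index _ _ (by simp)]

lemma coeffSum_one (f : ℕ → ℝ) : coeffSum f 1 = f 0 := by
  simpa using coeffSum_monomial f 0 1

lemma coeffSum_C_mul (f : ℕ → ℝ) (c : ℝ) (P : ℝ[X]) : coeffSum f (C c * P) = c * coeffSum f P := by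
  rw [← smul_eq_C_mul, map_smul, smul_eq_mul]

lemma coeffSum_X_mul (f : ℕ → ℝ) (P : ℝ[X]) :
    coeffSum f (X * P) = coeffSum (fun k => f (k + 1)) P := by
  induction P using Polynomial.induction_on' with
  | add p q hp hq => rw [mul_add, map_add, map_add, hp, hq]
  | monomial n a => rw [X_mul_monomial, coeffSum_monomial, coeffSum_monomial]

lemma coeffSum_sub_left (f g : ℕ → ℝ) (P : ℝ[X]) :
    coeffSum (fun k => f k - g k) P = coeffSum f P - coeffSum g P := by
  simp only [coeffSum_eq_sum _ (Nat.lt_succ_self P.natDegree), sub_mul, sum_sub_distrib]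

/-- The probability generating function `(1 - p) + p X` of a Bernoulli variable. -/
noncomputable def bernoulliPoly (p : ℝ) : ℝ[X] := C (1 - p) + C p * X

lemma coeffSum_bernoulliPoly_mul (f : ℕ → ℝ) (p : ℝ) (P : ℝ[X]) :
    coeffSum f (bernoulliPoly p * P) =
      (1 - p) * coeffSum f P + p * coeffSum (fun k => f (k + 1)) P := by
  rw [bernoulliPoly, add_mul, mul_assoc, map_add, coeffSum_C_mul, coeffSum_C_mul, coeffSum_X_mul]

lemma natDegree_bernoulliPoly_le (p : ℝ) : (bernoulliPoly p).natDegree ≤ 1 := by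
  unfold bernoulliPoly; compute_degree

lemma coeff_mul_nonneg {P Q : ℝ[X]} (hP : ∀ k, 0 ≤ P.coeff k) (hQ : ∀ k, 0 ≤ Q.coeff k) (k : ℕ) :
    0 ≤ (P * Q).coeff k := by
  rw [coeff_mul]
  exact sum_nonneg fun x _ => mul_nonneg (hP _) (hQ _)

lemma coeff_bernoulliPoly_nonneg {p : ℝ} (h0 : 0 ≤ p) (h1 : p ≤ 1) (k : ℕ) :
    0 ≤ (bernoulliPoly p).coeff k := by
  rcases k with _ | _ | k
  · simpa [bernoulliPoly] using h1
  · simpa [bernoulliPoly, -map_sub, coeff_C] using h0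
  · simp [bernoulliPoly, -map_sub]

/-- The generating function of a sum of independent Bernoulli variables. -/
noncomputable def poissonBinomialPoly (s : Multiset ℝ) : ℝ[X] := (s.map bernoulliPoly).prod

lemma poissonBinomialPoly_zero : poissonBinomialPoly 0 = 1 := by simp [poissonBinomialPoly]

lemma poissonBinomialPoly_cons (p : ℝ) (s : Multiset ℝ) :
    poissonBinomialPoly (p ::ₘ s) = bernoulliPoly p * poissonBinomialPoly s := by
  simp [poissonBinomialPoly]

lemma poissonBinomialPoly_replicate (n : ℕ) (p : ℝ) :
    poissonBinomialPoly (Multiset.replicate n p) = bernoulliPoly p ^ n := by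
  simp [poissonBinomialPoly]

lemma coeff_poissonBinomialPoly_nonneg {s : Multiset ℝ} (hs : ∀ p ∈ s, 0 ≤ p ∧ p ≤ 1) :
    ∀ k, 0 ≤ (poissonBinomialPoly s).coeff k := by
  induction s using Multiset.induction with
  | empty =>
    intro k
    rw [poissonBinomialPoly_zero, coeff_one]
    split_ifs <;> norm_num
  | cons p s ih =>
    rw [poissonBinomialPoly_cons]
    have hp := hs p (Multiset.mem_cons_self _ _)
    exact coeff_mul_nonneg (coeff_bernoulliPoly_nonneg hp.1 hp.2)
      (ih fun q hq => hs q (Multiset.mem_cons_of_mem hq))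

lemma natDegree_poissonBinomialPoly_le (s : Multiset ℝ) :
    (poissonBinomialPoly s).natDegree ≤ Multiset.card s := by
  induction s using Multiset.induction with
  | empty => simp [poissonBinomialPoly_zero]
  | cons p s ih =>
    rw [poissonBinomialPoly_cons, Multiset.card_cons, add_comm]
    exact natDegree_mul_le_of_le (natDegree_bernoulliPoly_le p) ih

/-- Affine expectations see only the mean `s.sum`; the case `b = 0` gives the total mass. -/
lemma coeffSum_affine_poissonBinomialPoly (a b : ℝ) (s : Multiset ℝ) :
    coeffSum (fun k => a + b * k) (poissonBinomialPoly s) = a + b * s.sum := by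
  induction s using Multiset.induction generalizing a with
  | empty => simp [poissonBinomialPoly_zero, coeffSum_one]
  | cons p s ih =>
    have h : (fun k : ℕ => a + b * ((k + 1 : ℕ) : ℝ)) = fun k : ℕ => (a + b) + b * (k : ℝ) := by
      ext k; push_cast; ring
    rw [poissonBinomialPoly_cons, coeffSum_bernoulliPoly_mul, h, ih, ih, Multiset.sum_cons]
    ring

/-- `f` is discretely concave on `{0, …, N}`. -/
def ConcaveUpTo (N : ℕ) (f : ℕ → ℝ) : Prop := ∀ k, k + 2 ≤ N → f k + f (k + 2) ≤ 2 * f (k + 1)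

/-- Summation by parts: pairing `f` with `(X - 1)² P` is pairing the second difference of `f` with
`P`. -/
lemma coeffSum_sub_one_sq_mul_nonpos {N : ℕ} {f : ℕ → ℝ} (hf : ConcaveUpTo N f) {P : ℝ[X]}
    (hP : ∀ k, 0 ≤ P.coeff k) (hd : P.natDegree + 2 ≤ N) : coeffSum f ((X - 1) ^ 2 * P) ≤ 0 := by
  have h : (X - 1) ^ 2 * P = X * (X * P) - C 2 * (X * P) + P := by
    rw [show (C 2 : ℝ[X]) = 2 from rfl]; ring
  rw [h, map_add, map_sub, coeffSum_C_mul, coeffSum_X_mul, coeffSum_X_mul, coeffSum_X_mul]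
  have hlt : P.natDegree < N - 1 := by omega
  simp only [coeffSum_eq_sum _ hlt]
  rw [mul_sum, ← sum_sub_distrib, ← sum_add_distrib]
  refine sum_nonpos fun k hk => ?_
  have := mul_le_mul_of_nonneg_right (hf k (by have := mem_range.1 hk; omega)) (hP k)
  linarith

/-- Hoeffding's comparison: for concave `f`, replacing Bernoulli parameters by their average `m`
can only decrease the expectation of `f`. -/
lemma coeffSum_pow_mul_le {N : ℕ} {f : ℕ → ℝ} (hf : ConcaveUpTo N f) {m : ℝ} :
    ∀ (n : ℕ) (s : Multiset ℝ) (R : ℝ[X]), Multiset.card s = n → (∀ p ∈ s, 0 ≤ p ∧ p ≤ 1) →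
      s.sum = n * m → (∀ k, 0 ≤ R.coeff k) → R.natDegree + n ≤ N →
      coeffSum f (bernoulliPoly m ^ n * R) ≤ coeffSum f (poissonBinomialPoly s * R) := by
  intro n
  induction n with
  | zero =>
    intro s R hs _ _ _ _
    rw [Multiset.card_eq_zero.1 hs, poissonBinomialPoly_zero, pow_zero]
  | succ n ih =>
    intro s R hs h01 hsum hR hdeg
    have hdeg' (p : ℝ) : (bernoulliPoly p * R).natDegree + n ≤ N := by
      have := natDegree_mul_le_of_le (natDegree_bernoulliPoly_le p) (le_refl R.natDegree)
      omega
    by_cases hm : m ∈ s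
    -- A parameter already equal to `m` is moved into `R`, which collects the averaged factors.
    · obtain ⟨t, rfl⟩ := Multiset.exists_cons_of_mem hm
      have hm01 := h01 m hm
      rw [Multiset.sum_cons] at hsum
      have := ih t (bernoulliPoly m * R) (by simpa using hs)
        (fun p hp => h01 p (Multiset.mem_cons_of_mem hp)) (by push_cast at hsum; linarith)
        (coeff_mul_nonneg (coeff_bernoulliPoly_nonneg hm01.1 hm01.2) hR) (hdeg' m)
      rw [poissonBinomialPoly_cons, pow_succ]
      convert this using 2 <;> ring
    · have hlow : ∃ p ∈ s, p < m := by
        by_contra! hcon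
        have : (s.map fun _ => m).sum < (s.map id).sum :=
          Multiset.sum_lt_sum (fun i hi => hcon i hi) (by
            obtain ⟨a, ha⟩ := Multiset.card_pos_iff_exists_mem.1 (by omega : 0 < Multiset.card s)
            exact ⟨a, ha, lt_of_le_of_ne (hcon a ha) fun h => hm (h ▸ ha)⟩)
        simp [hs, hsum] at this
        linarith
      have hhigh : ∃ p ∈ s, m < p := by
        by_contra! hcon
        have : (s.map id).sum < (s.map fun _ => m).sum :=
          Multiset.sum_lt_sum (fun i hi => hcon i hi) (by
            obtain ⟨a, ha⟩ := Multiset.card_pos_iff_exists_mem.1 (by omega : 0 < Multiset.card s)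
            exact ⟨a, ha, lt_of_le_of_ne (hcon a ha) fun h => hm (h ▸ ha)⟩)
        simp [hs, hsum] at this
        linarith
      obtain ⟨p, hps, hpm⟩ := hlow
      obtain ⟨r, hrs, hmr⟩ := hhigh
      obtain ⟨s', rfl⟩ := Multiset.exists_cons_of_mem hps
      have hr' : r ∈ s' := by
        rcases Multiset.mem_cons.1 hrs with h | h
        · exact absurd h (by linarith)
        · exact h
      obtain ⟨t, rfl⟩ := Multiset.exists_cons_of_mem hr'
      have hp01 := h01 p hps
      have hr01 := h01 r hrs
      have ht01 : ∀ q ∈ t, 0 ≤ q ∧ q ≤ 1 := fun q hq =>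
        h01 q (Multiset.mem_cons_of_mem (Multiset.mem_cons_of_mem hq))
      rw [Multiset.sum_cons, Multiset.sum_cons] at hsum
      simp only [Multiset.card_cons] at hs
      -- With `p < m < r`, the pair `p, r` becomes `m, p + r - m`: the sum is kept and one more
      -- parameter equals `m`.
      have key := ih ((p + r - m) ::ₘ t) (bernoulliPoly m * R) (by simp; omega)
        (by
          intro q hq
          rcases Multiset.mem_cons.1 hq with rfl | hq
          · constructor <;> linarith
          · exact ht01 q hq)
        (by rw [Multiset.sum_cons]; push_cast at hsum; linarith)
        (coeff_mul_nonneg (coeff_bernoulliPoly_nonneg (by linarith) (by linarith)) hR) (hdeg' m)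
      have hQ : (poissonBinomialPoly t * R).natDegree + 2 ≤ N := by
        have := natDegree_mul_le_of_le (natDegree_poissonBinomialPoly_le t) (le_refl R.natDegree)
        omega
      have hneg := coeffSum_sub_one_sq_mul_nonpos hf
        (coeff_mul_nonneg (coeff_poissonBinomialPoly_nonneg ht01) hR) hQ
      -- In powers of `X - 1`, the two products of two factors differ only at `(X - 1)²`, by `m (p +
      -- r - m) - p r = (m - p) (r - m)`.
      have hid : poissonBinomialPoly ((p + r - m) ::ₘ t) * (bernoulliPoly m * R) =
          poissonBinomialPoly (p ::ₘ r ::ₘ t) * R +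
            C ((m - p) * (r - m)) * ((X - 1) ^ 2 * (poissonBinomialPoly t * R)) := by
        simp only [poissonBinomialPoly_cons, bernoulliPoly, C_mul, C_sub, C_add, C_1]
        ring
      rw [hid, map_add, coeffSum_C_mul] at key
      have : (m - p) * (r - m) * coeffSum f ((X - 1) ^ 2 * (poissonBinomialPoly t * R)) ≤ 0 :=
        mul_nonpos_of_nonneg_of_nonpos (mul_nonneg (by linarith) (by linarith)) hneg
      calc _ = coeffSum f (bernoulliPoly m ^ n * (bernoulliPoly m * R)) := by
            congr 1; ring
        _ ≤ _ := by linarith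

lemma coeff_bernoulliPoly_pow (p : ℝ) (n k : ℕ) :
    (bernoulliPoly p ^ n).coeff k = n.choose k * p ^ k * (1 - p) ^ (n - k) := by
  have h : bernoulliPoly p ^ n =
      ∑ j ∈ range (n + 1), C (n.choose j * p ^ j * (1 - p) ^ (n - j)) * X ^ j := by
    rw [bernoulliPoly, add_comm, add_pow]
    refine sum_congr rfl fun j _ => ?_
    simp only [C_mul, C_pow, mul_pow, map_natCast]
    ring
  rw [h, finsetSum_coeff]
  simp only [coeff_C_mul, coeff_X_pow]
  rcases lt_or_ge k (n + 1) with hk | hk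
  · rw [sum_eq_single_of_mem k (mem_range.2 hk) (by intro j _ hj; simp [Ne.symm hj])]
    simp
  · rw [Nat.choose_eq_zero_of_lt (by omega)]
    simp only [Nat.cast_zero, zero_mul]
    exact sum_eq_zero fun j hj => by
      have := mem_range.1 hj
      rw [if_neg (by omega), mul_zero]

lemma natDegree_bernoulliPoly_pow_lt (p : ℝ) (n : ℕ) :
    (bernoulliPoly p ^ n).natDegree < n + 1 := by
  rw [← poissonBinomialPoly_replicate]
  have := natDegree_poissonBinomialPoly_le (Multiset.replicate n p)
  rw [Multiset.card_replicate] at this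
  omega

lemma coeffSum_bernoulliPoly_pow (f : ℕ → ℝ) (p : ℝ) (n : ℕ) :
    coeffSum f (bernoulliPoly p ^ n) =
      ∑ k ∈ range (n + 1), f k * (n.choose k * p ^ k * (1 - p) ^ (n - k)) := by
  rw [coeffSum_eq_sum f (natDegree_bernoulliPoly_pow_lt p n)]
  simp only [coeff_bernoulliPoly_pow]

/-- Differentiating in `p` turns `f` into its forward difference and drops one trial. The truncated
`n - 1` is harmless at `n = 0`, where the factor `n` vanishes. -/
lemma hasDerivAt_coeffSum_bernoulliPoly_pow (n : ℕ) (f : ℕ → ℝ) (p : ℝ) :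
    HasDerivAt (fun p => coeffSum f (bernoulliPoly p ^ n))
      (n * coeffSum (fun k => f (k + 1) - f k) (bernoulliPoly p ^ (n - 1))) p := by
  induction n generalizing f with
  | zero => simpa using hasDerivAt_const p _
  | succ n ih =>
    have h := (((hasDerivAt_id p).const_sub 1).mul (ih f)).add
      ((hasDerivAt_id p).mul (ih fun k => f (k + 1)))
    simp only [pow_succ', coeffSum_bernoulliPoly_mul]
    refine h.congr_deriv ?_
    simp only [id, Nat.add_sub_cancel]
    rcases n with _ | n
    · simp [coeffSum_one]
      ring
    · have e := coeffSum_bernoulliPoly_mul (fun k => f (k + 1) - f k) p (bernoulliPoly p ^ n)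
      rw [← pow_succ'] at e
      have e2 := coeffSum_sub_left (fun k => f (k + 1)) f (bernoulliPoly p ^ (n + 1))
      simp only [Nat.add_sub_cancel]
      push_cast
      linear_combination (-(n + 1 : ℝ)) * e - e2

lemma coeffSum_mono {f g : ℕ → ℝ} {P : ℝ[X]} (hP : ∀ k, 0 ≤ P.coeff k)
    (h : ∀ k ≤ P.natDegree, f k ≤ g k) : coeffSum f P ≤ coeffSum g P := by
  rw [coeffSum_eq_sum f (Nat.lt_succ_self _), coeffSum_eq_sum g (Nat.lt_succ_self _)]
  exact sum_le_sum fun k hk =>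
    mul_le_mul_of_nonneg_right (h k (by have := mem_range.1 hk; omega)) (hP k)

end PoissonBinomial

/-! ### Binomial entropy and the maximum at `1/2`. -/

section BinomialEntropy

open Polynomial Finset

lemma log_choose_succ {n k : ℕ} (h : k < n) :
    Real.log (n.choose (k + 1)) =
      Real.log (n.choose k) + Real.log ((n : ℝ) - k) - Real.log (k + 1) := by
  have h1 : (n.choose (k + 1) : ℝ) * (k + 1) = n.choose k * ((n : ℝ) - k) := by
    have := Nat.choose_succ_right_eq n k
    rw [← Nat.cast_sub h.le]
    exact_mod_cast this
  have hk : (k : ℝ) < n := by exact_mod_cast h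
  have hc : (n.choose k : ℝ) ≠ 0 := by exact_mod_cast (Nat.choose_pos h.le).ne'
  have hc' : (n.choose (k + 1) : ℝ) ≠ 0 := by exact_mod_cast (Nat.choose_pos h).ne'
  have := congrArg Real.log h1
  rw [Real.log_mul hc' (by positivity), Real.log_mul hc (by linarith)] at this
  linarith

lemma log_choose_second_difference {n k : ℕ} (h : k + 2 ≤ n) :
    Real.log (n.choose (k + 2)) - 2 * Real.log (n.choose (k + 1)) + Real.log (n.choose k) =
      (Real.log (k + 1) - Real.log (k + 2)) +
        (Real.log ((n : ℝ) - k - 1) - Real.log ((n : ℝ) - k)) := by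
  have h1 := log_choose_succ (show k < n by omega)
  have h2 := log_choose_succ (show k + 1 < n by omega)
  push_cast at h2
  rw [show (n : ℝ) - (k + 1) = n - k - 1 by ring, show (k : ℝ) + 1 + 1 = k + 2 by ring] at h2
  rw [h2, h1]
  ring

lemma concaveUpTo_log_choose (n : ℕ) : ConcaveUpTo n fun k => Real.log (n.choose k) := by
  intro k hk
  have hn : (k : ℝ) + 2 ≤ n := by exact_mod_cast hk
  have h := log_choose_second_difference hk
  have h1 : Real.log (k + 1) ≤ Real.log (k + 2) := Real.log_le_log (by positivity) (by linarith)
  have h2 : Real.log ((n : ℝ) - k - 1) ≤ Real.log ((n : ℝ) - k) :=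
    Real.log_le_log (by linarith) (by linarith)
  simp only
  linarith

lemma log_add_one_sub_log_le {x : ℝ} (hx : 0 < x) : Real.log (x + 1) - Real.log x ≤ 1 / x := by
  rw [← Real.log_div (by linarith) hx.ne']
  refine (Real.log_le_sub_one_of_pos (by positivity)).trans (le_of_eq ?_)
  field_simp
  ring

lemma neg_log_choose_second_difference_le {n k : ℕ} (h : k + 2 ≤ n) :
    -(1 / ((k : ℝ) + 1) + 1 / ((n : ℝ) - k - 1)) ≤
      Real.log (n.choose (k + 2)) - 2 * Real.log (n.choose (k + 1)) + Real.log (n.choose k) := by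
  have hn : (k : ℝ) + 2 ≤ n := by exact_mod_cast h
  rw [log_choose_second_difference h]
  have h1 := log_add_one_sub_log_le (show (0 : ℝ) < k + 1 by positivity)
  have h2 := log_add_one_sub_log_le (show (0 : ℝ) < (n : ℝ) - k - 1 by linarith)
  rw [show (k : ℝ) + 1 + 1 = k + 2 by ring] at h1
  rw [show (n : ℝ) - k - 1 + 1 = n - k by ring] at h2
  linarith

lemma sum_binomial_eq_one (p : ℝ) (n : ℕ) :
    ∑ k ∈ range (n + 1), (n.choose k : ℝ) * p ^ k * (1 - p) ^ (n - k) = 1 := by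
  have := add_pow p (1 - p) n
  rw [add_sub_cancel, one_pow] at this
  exact (sum_congr rfl fun k _ => by ring).trans this.symm

/-- By absorption, the term at `k` is the mass of `Bin(m + 1, p)` at `k + 1`; only the mass at `0`
is missing from the total `1`. -/
lemma mul_coeffSum_inv_succ_le {p : ℝ} (h1 : p ≤ 1) (m : ℕ) :
    p * ((m + 1) * coeffSum (fun k => 1 / ((k : ℝ) + 1)) (bernoulliPoly p ^ m)) ≤ 1 := by
  have hq : 0 ≤ 1 - p := by linarith
  refine le_of_le_of_eq ?_ (sum_binomial_eq_one p (m + 1))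
  rw [coeffSum_bernoulliPoly_pow, mul_sum, mul_sum, sum_range_succ' _ (m + 1)]
  refine le_add_of_le_of_nonneg (sum_le_sum fun k _ => le_of_eq ?_) (by positivity)
  have h : ((m : ℝ) + 1) * m.choose k = (m + 1).choose (k + 1) * (k + 1) := by
    exact_mod_cast Nat.add_one_mul_choose_eq m k
  have hk : (k : ℝ) + 1 ≠ 0 := by positivity
  have h' : ((m + 1).choose (k + 1) : ℝ) = (m + 1) * m.choose k / (k + 1) := by
    rw [eq_div_iff hk, h]
  rw [h', Nat.add_sub_add_right, pow_succ]
  ring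

/-- Here the term at `k` is the mass of `Bin(m + 1, p)` at `k`; only the mass at `m + 1` is missing.
-/
lemma mul_coeffSum_inv_sub_le {p : ℝ} (h0 : 0 ≤ p) (h1 : p ≤ 1) (m : ℕ) :
    (1 - p) * ((m + 1) * coeffSum (fun k => 1 / ((m : ℝ) + 1 - k)) (bernoulliPoly p ^ m)) ≤ 1 := by
  have hq : 0 ≤ 1 - p := by linarith
  refine le_of_le_of_eq ?_ (sum_binomial_eq_one p (m + 1))
  rw [coeffSum_bernoulliPoly_pow, mul_sum, mul_sum, sum_range_succ _ (m + 1)]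
  refine le_add_of_le_of_nonneg (sum_le_sum fun k hk => le_of_eq ?_) (by positivity)
  have hkm : k ≤ m := by have := mem_range.1 hk; omega
  have hkm' : (k : ℝ) ≤ m := by exact_mod_cast hkm
  have h : (m.choose k : ℝ) * (m + 1) = (m + 1).choose k * ((m : ℝ) + 1 - k) := by
    have := Nat.choose_mul_succ_eq m k
    rw [show (m : ℝ) + 1 - k = ((m + 1 - k : ℕ) : ℝ) by rw [Nat.cast_sub (by omega)]; push_cast; ring]
    exact_mod_cast this
  have hk0 : (m : ℝ) + 1 - k ≠ 0 := by linarith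
  have h' : ((m + 1).choose k : ℝ) = m.choose k * (m + 1) / (m + 1 - k) := by
    rw [eq_div_iff hk0, h]
  rw [h', show m + 1 - k = (m - k) + 1 by omega, pow_succ]
  ring

/-- The entropy (in nats) of `Bin(n, p)`, as `n h(p)` minus the mean of the logarithm of the
binomial coefficient. -/
noncomputable def binomialEntropy (n : ℕ) (p : ℝ) : ℝ :=
  n * Real.binEntropy p - coeffSum (fun k => Real.log (n.choose k)) (bernoulliPoly p ^ n)

lemma neg_inv_add_inv_le_coeffSum {p : ℝ} (h0 : 0 < p) (h1 : p < 1) (m : ℕ) :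
    -(1 / p + 1 / (1 - p)) ≤ (m + 1) * coeffSum (fun k =>
      Real.log ((m + 2).choose (k + 1 + 1)) - Real.log ((m + 2).choose (k + 1)) -
        (Real.log ((m + 2).choose (k + 1)) - Real.log ((m + 2).choose k)))
      (bernoulliPoly p ^ m) := by
  have hq : 0 < 1 - p := by linarith
  have hnn : ∀ k, 0 ≤ (bernoulliPoly p ^ m).coeff k := fun k => by
    rw [coeff_bernoulliPoly_pow]; positivity
  have hle : coeffSum (fun k => 0 - 1 / ((k : ℝ) + 1) - 1 / ((m : ℝ) + 1 - k))
      (bernoulliPoly p ^ m) ≤ coeffSum (fun k =>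
      Real.log ((m + 2).choose (k + 1 + 1)) - Real.log ((m + 2).choose (k + 1)) -
        (Real.log ((m + 2).choose (k + 1)) - Real.log ((m + 2).choose k)))
      (bernoulliPoly p ^ m) := by
    refine coeffSum_mono hnn fun k hk => ?_
    have hk' := natDegree_bernoulliPoly_pow_lt p m
    have := neg_log_choose_second_difference_le (show k + 2 ≤ m + 2 by omega)
    push_cast at this
    rw [show (m : ℝ) + 2 - k - 1 = m + 1 - k by ring] at this
    linarith
  rw [coeffSum_sub_left, coeffSum_sub_left] at hle
  have hz : coeffSum (fun _ => 0) (bernoulliPoly p ^ m) = 0 := by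
    rw [coeffSum_bernoulliPoly_pow]; simp
  rw [hz] at hle
  have e1 := mul_coeffSum_inv_succ_le h1.le m
  have e2 := mul_coeffSum_inv_sub_le h0.le h1.le m
  rw [← le_div_iff₀' h0] at e1
  rw [← le_div_iff₀' hq] at e2
  have := mul_le_mul_of_nonneg_left hle (show (0 : ℝ) ≤ m + 1 by positivity)
  linarith

/-- The second derivative is `n` times `-1/p - 1/(1-p) - (n-1) E Δ² log C(n, ·)`, the mean being
under `Bin(n-2, p)`; `neg_inv_add_inv_le_coeffSum` makes it nonpositive. -/
lemma concaveOn_binomialEntropy (n : ℕ) : ConcaveOn ℝ (Set.Ioo 0 1) (binomialEntropy n) := by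
  let g : ℕ → ℝ := fun k => Real.log (n.choose k)
  have hd : ∀ p ∈ Set.Ioo (0 : ℝ) 1, HasDerivAt (binomialEntropy n)
      (n * (Real.log (1 - p) - Real.log p) -
        n * coeffSum (fun k => g (k + 1) - g k) (bernoulliPoly p ^ (n - 1))) p := fun p hp =>
    ((Real.hasDerivAt_binEntropy hp.1.ne' hp.2.ne).const_mul (n : ℝ)).sub
      (hasDerivAt_coeffSum_bernoulliPoly_pow n g p)
  have hd2 : ∀ p ∈ Set.Ioo (0 : ℝ) 1, HasDerivAt
      (fun p => n * (Real.log (1 - p) - Real.log p) -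
        n * coeffSum (fun k => g (k + 1) - g k) (bernoulliPoly p ^ (n - 1)))
      (n * ((-1) / (1 - p) - 1 / p) - n * ((n - 1 : ℕ) *
        coeffSum (fun k => g (k + 1 + 1) - g (k + 1) - (g (k + 1) - g k))
          (bernoulliPoly p ^ (n - 1 - 1)))) p := by
    intro p hp
    have l1 := ((hasDerivAt_id p).const_sub 1).log (by simpa using (sub_pos.2 hp.2).ne')
    have l2 := (hasDerivAt_id p).log hp.1.ne'
    exact ((l1.sub l2).const_mul (n : ℝ)).sub
      ((hasDerivAt_coeffSum_bernoulliPoly_pow (n - 1) _ p).const_mul (n : ℝ))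
  refine concaveOn_of_hasDerivWithinAt2_nonpos (convex_Ioo 0 1)
    (fun p hp => (hd p hp).continuousAt.continuousWithinAt)
    (fun p hp => (hd p (interior_subset hp)).hasDerivWithinAt)
    (fun p hp => (hd2 p (interior_subset hp)).hasDerivWithinAt) fun p hp => ?_
  have hp := interior_subset hp
  have hq : 0 < 1 - p := sub_pos.2 hp.2
  rw [← mul_sub]
  refine mul_nonpos_of_nonneg_of_nonpos n.cast_nonneg ?_
  have hpos : 0 < 1 / p := one_div_pos.2 hp.1
  have hpos' : 0 < 1 / (1 - p) := one_div_pos.2 hq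
  rw [neg_div]
  -- For `n ≤ 1` the truncated factor `n - 1` is zero and only the binary entropy term remains.
  rcases n with _ | _ | m
  · simp only [Nat.zero_sub, Nat.cast_zero, zero_mul]; linarith
  · simp only [zero_add, Nat.sub_self, Nat.cast_zero, zero_mul]; linarith
  · have := neg_inv_add_inv_le_coeffSum hp.1 hp.2 m
    simp only [g, show m + 1 + 1 = m + 2 from rfl]
    push_cast at this ⊢
    linarith

lemma binomialEntropy_one_sub (n : ℕ) (p : ℝ) : binomialEntropy n (1 - p) = binomialEntropy n p := by
  rw [binomialEntropy, binomialEntropy, Real.binEntropy_one_sub, coeffSum_bernoulliPoly_pow,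
    coeffSum_bernoulliPoly_pow, ← sum_range_reflect]
  congr 1
  refine sum_congr rfl fun k hk => ?_
  have hk : k ≤ n := by have := mem_range.1 hk; omega
  rw [show n + 1 - 1 - k = n - k by omega, Nat.choose_symm hk, Nat.sub_sub_self hk]
  ring

lemma binomialEntropy_le_half (n : ℕ) {p : ℝ} (h0 : 0 < p) (h1 : p < 1) :
    binomialEntropy n p ≤ binomialEntropy n (1 / 2) := by
  have h := (concaveOn_binomialEntropy n).2 (show p ∈ Set.Ioo (0 : ℝ) 1 from ⟨h0, h1⟩)
    (show 1 - p ∈ Set.Ioo (0 : ℝ) 1 from ⟨by linarith, by linarith⟩)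
    (show (0 : ℝ) ≤ 1 / 2 by norm_num) (show (0 : ℝ) ≤ 1 / 2 by norm_num) (by norm_num)
  rw [binomialEntropy_one_sub, smul_eq_mul, smul_eq_mul, smul_eq_mul,
    show 1 / 2 * p + 1 / 2 * (1 - p) = 1 / 2 by ring] at h
  linarith

lemma log_coeff_bernoulliPoly_pow {p : ℝ} (h0 : 0 < p) (h1 : p < 1) {n k : ℕ} (hk : k ≤ n) :
    Real.log ((bernoulliPoly p ^ n).coeff k) =
      Real.log (n.choose k) + k * Real.log p + (n - k) * Real.log (1 - p) := by
  have hq : 0 < 1 - p := by linarith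
  have hc : (n.choose k : ℝ) ≠ 0 := by exact_mod_cast (Nat.choose_pos hk).ne'
  rw [coeff_bernoulliPoly_pow, Real.log_mul (by positivity) (by positivity),
    Real.log_mul hc (by positivity), Real.log_pow, Real.log_pow, Nat.cast_sub hk]

/-- The entropy (in nats) of the law on `{0, …, n}` with generating function `P`. -/
noncomputable def coeffEntropy (n : ℕ) (P : ℝ[X]) : ℝ :=
  ∑ k ∈ range (n + 1), Real.negMulLog (P.coeff k)

/-- From `log x ≤ x - 1` at `x = b / a`; the correction `b - a` cancels when summed over two laws.
-/
lemma negMulLog_le_gibbs {a b : ℝ} (ha : 0 ≤ a) (hb : 0 < b) :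
    Real.negMulLog a ≤ -(Real.log b * a) + (b - a) := by
  rcases ha.eq_or_lt with rfl | ha
  · simpa using hb.le
  · have h := mul_le_mul_of_nonneg_left (Real.log_le_sub_one_of_pos (div_pos hb ha)) ha.le
    rw [Real.log_div hb.ne' ha.ne', mul_sub, mul_sub, mul_div_cancel₀ _ ha.ne'] at h
    rw [Real.negMulLog]
    linarith

lemma sum_coeff_poissonBinomialPoly {n : ℕ} {s : Multiset ℝ} (hs : Multiset.card s = n) :
    ∑ k ∈ range (n + 1), (poissonBinomialPoly s).coeff k = 1 := by
  have h := coeffSum_affine_poissonBinomialPoly 1 0 s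
  rw [coeffSum_eq_sum _ (Nat.lt_succ_of_le ((natDegree_poissonBinomialPoly_le s).trans hs.le))] at h
  simpa using h

/-- The log-mass of `Bin(n, m)` is `log C(n, k)` plus an affine function of `k`, whose mean depends
only on `s.sum`. -/
lemma sum_log_mul_coeff {n : ℕ} {s : Multiset ℝ} (hs : Multiset.card s = n) {m : ℝ}
    (hm : s.sum = n * m) (h0 : 0 < m) (h1 : m < 1) :
    ∑ k ∈ range (n + 1), Real.log ((bernoulliPoly m ^ n).coeff k) * (poissonBinomialPoly s).coeff k =
      coeffSum (fun k => Real.log (n.choose k)) (poissonBinomialPoly s) - n * Real.binEntropy m := by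
  have hdeg : (poissonBinomialPoly s).natDegree < n + 1 :=
    Nat.lt_succ_of_le ((natDegree_poissonBinomialPoly_le s).trans hs.le)
  have h := coeffSum_affine_poissonBinomialPoly (n * Real.log (1 - m))
    (Real.log m - Real.log (1 - m)) s
  rw [hm, coeffSum_eq_sum _ hdeg] at h
  have hb : (n : ℝ) * Real.binEntropy m =
      -(n * Real.log (1 - m) + (Real.log m - Real.log (1 - m)) * (n * m)) := by
    rw [Real.binEntropy_eq_negMulLog_add_negMulLog_one_sub, Real.negMulLog, Real.negMulLog]
    ring
  rw [hb, ← h, coeffSum_eq_sum _ hdeg, sub_neg_eq_add, ← sum_add_distrib]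
  refine sum_congr rfl fun k hk => ?_
  rw [log_coeff_bernoulliPoly_pow h0 h1 (by have := mem_range.1 hk; omega)]
  ring

lemma coeffEntropy_half (n : ℕ) :
    coeffEntropy n (bernoulliPoly (1 / 2) ^ n) = binomialEntropy n (1 / 2) := by
  have h := sum_log_mul_coeff (s := Multiset.replicate n (1 / 2 : ℝ)) (n := n) (by simp)
    (m := 1 / 2) (by simp) (by norm_num) (by norm_num)
  rw [poissonBinomialPoly_replicate] at h
  rw [binomialEntropy, ← neg_sub, ← h, coeffEntropy, ← sum_neg_distrib]
  exact sum_congr rfl fun k _ => by rw [Real.negMulLog]; ring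

/-- A sum of `n` independent Bernoulli variables has entropy at most that of `Bin(n, 1/2)`. -/
theorem coeffEntropy_poissonBinomialPoly_le {n : ℕ} {s : Multiset ℝ} (hs : Multiset.card s = n)
    (h01 : ∀ p ∈ s, 0 ≤ p ∧ p ≤ 1) :
    coeffEntropy n (poissonBinomialPoly s) ≤ coeffEntropy n (bernoulliPoly (1 / 2) ^ n) := by
  have hhalf : 0 ≤ coeffEntropy n (bernoulliPoly (1 / 2) ^ n) := by
    have hs' : Multiset.card (Multiset.replicate n (1 / 2 : ℝ)) = n := by simp
    have hnn : ∀ k, 0 ≤ (bernoulliPoly (1 / 2) ^ n).coeff k := fun k => by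
      rw [coeff_bernoulliPoly_pow]; norm_num
    have hsum := sum_coeff_poissonBinomialPoly hs'
    rw [poissonBinomialPoly_replicate] at hsum
    exact sum_nonneg fun k hk => Real.negMulLog_nonneg (hnn k)
      ((single_le_sum (fun j _ => hnn j) hk).trans_eq hsum)
  have hdet : ∀ Q : ℝ[X], (∀ k, Q.coeff k = 0 ∨ Q.coeff k = 1) →
      coeffEntropy n Q ≤ coeffEntropy n (bernoulliPoly (1 / 2) ^ n) := by
    intro Q hQ
    refine le_trans (le_of_eq (sum_eq_zero fun k _ => ?_)) hhalf
    rcases hQ k with h | h <;> simp [h]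
  -- Point masses are treated apart, so that `0 < m < 1` and the logarithms below are of positive
  -- numbers.
  by_cases hall0 : ∀ p ∈ s, p = 0
  · rw [Multiset.eq_replicate.2 ⟨hs, hall0⟩, poissonBinomialPoly_replicate]
    refine hdet _ fun k => ?_
    simp only [bernoulliPoly, sub_zero, C_1, C_0, zero_mul, add_zero, one_pow, coeff_one]
    split_ifs <;> simp
  by_cases hall1 : ∀ p ∈ s, p = 1
  · rw [Multiset.eq_replicate.2 ⟨hs, hall1⟩, poissonBinomialPoly_replicate]
    refine hdet _ fun k => ?_
    simp only [bernoulliPoly, sub_self, C_1, C_0, zero_add, one_mul, coeff_X_pow]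
    split_ifs <;> simp
  push Not at hall0 hall1
  obtain ⟨a, has, ha⟩ := hall0
  obtain ⟨b, hbs, hb⟩ := hall1
  have hn : (0 : ℝ) < n := by
    have : 0 < Multiset.card s := Multiset.card_pos_iff_exists_mem.2 ⟨a, has⟩
    exact_mod_cast hs ▸ this
  have hpos : (s.map fun _ => (0 : ℝ)).sum < (s.map id).sum :=
    Multiset.sum_lt_sum (fun i hi => (h01 i hi).1) ⟨a, has, lt_of_le_of_ne (h01 a has).1 ha.symm⟩
  have hlt : (s.map id).sum < (s.map fun _ => (1 : ℝ)).sum :=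
    Multiset.sum_lt_sum (fun i hi => (h01 i hi).2) ⟨b, hbs, lt_of_le_of_ne (h01 b hbs).2 hb⟩
  simp only [Multiset.map_const', Multiset.sum_replicate, smul_zero, Multiset.map_id, hs,
    nsmul_eq_mul, mul_one] at hpos hlt
  obtain ⟨m, hm⟩ : ∃ m, s.sum = n * m := ⟨s.sum / n, by field_simp⟩
  have h0 : 0 < m := by
    rw [hm] at hpos
    exact pos_of_mul_pos_right hpos hn.le
  have h1 : m < 1 := by
    rw [hm] at hlt
    nlinarith
  have hq : 0 < 1 - m := by linarith
  have hgibbs : coeffEntropy n (poissonBinomialPoly s) ≤ ∑ k ∈ range (n + 1),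
      (-(Real.log ((bernoulliPoly m ^ n).coeff k) * (poissonBinomialPoly s).coeff k) +
        ((bernoulliPoly m ^ n).coeff k - (poissonBinomialPoly s).coeff k)) := by
    refine sum_le_sum fun k hk =>
      negMulLog_le_gibbs (coeff_poissonBinomialPoly_nonneg h01 k) ?_
    have : 0 < n.choose k := Nat.choose_pos (by have := mem_range.1 hk; omega)
    rw [coeff_bernoulliPoly_pow]
    positivity
  have hsum := sum_coeff_poissonBinomialPoly (s := Multiset.replicate n m) (n := n) (by simp)
  rw [poissonBinomialPoly_replicate] at hsum
  rw [sum_add_distrib, sum_sub_distrib, hsum, sum_coeff_poissonBinomialPoly hs, sub_self, add_zero,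
    sum_neg_distrib, sum_log_mul_coeff hs hm h0 h1] at hgibbs
  have hcx := coeffSum_pow_mul_le (concaveUpTo_log_choose n) n s 1 hs h01 hm
    (fun k => by rw [coeff_one]; split_ifs <;> norm_num) (by simp)
  rw [mul_one, mul_one] at hcx
  have hmax := binomialEntropy_le_half n h0 h1
  rw [coeffEntropy_half]
  rw [binomialEntropy] at hmax
  linarith

end BinomialEntropy

/-! ### Reflection inequality, Hermite-Biehler and factorisation. -/

section HermiteBiehler

open Polynomial Finset

/-- At `z`, the polynomial `f` does not vanish, and it strictly dominates its reflection
`f(-z)` in modulus unless `f` is an even or an odd function. -/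
def DominatesReflection (f : ℝ[X]) (z : ℂ) : Prop :=
  aeval z f ≠ 0 ∧ (‖aeval (-z) f‖ < ‖aeval z f‖ ∨
    ∃ e : ℂ, (e = 1 ∨ e = -1) ∧ ∀ w : ℂ, aeval (-w) f = e * aeval w f)

lemma DominatesReflection.norm_le {f : ℝ[X]} {z : ℂ} (h : DominatesReflection f z) :
    ‖aeval (-z) f‖ ≤ ‖aeval z f‖ := by
  rcases h.2 with h | ⟨e, he, h⟩
  · exact h.le
  · rw [h z, norm_mul]
    rcases he with rfl | rfl <;> simp

lemma DominatesReflection.mul {f g : ℝ[X]} {z : ℂ} (hf : DominatesReflection f z)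
    (hg : DominatesReflection g z) : DominatesReflection (f * g) z := by
  refine ⟨by rw [map_mul]; exact mul_ne_zero hf.1 hg.1, ?_⟩
  have hf0 := norm_pos_iff.2 hf.1
  have hg0 := norm_pos_iff.2 hg.1
  simp only [map_mul, norm_mul]
  rcases hf.2 with h | ⟨e, he, h⟩
  · exact Or.inl (mul_lt_mul_of_lt_of_le_of_nonneg_of_pos h hg.norm_le (norm_nonneg _) hg0)
  · rcases hg.2 with h' | ⟨e', he', h'⟩
    · exact Or.inl (mul_lt_mul' hf.norm_le h' (norm_nonneg _) hf0)
    · refine Or.inr ⟨e * e', ?_, fun w => by rw [h, h']; ring⟩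
      rcases he with rfl | rfl <;> rcases he' with rfl | rfl <;> simp

lemma dominatesReflection_one (z : ℂ) : DominatesReflection 1 z :=
  ⟨by simp, Or.inr ⟨1, Or.inl rfl, by simp⟩⟩

lemma dominatesReflection_quadratic {a b c : ℝ} (ha : 0 ≤ a) (hb : 0 ≤ b) (hc : 0 ≤ c)
    (habc : 0 < a + b + c) {z : ℂ} (hz : 0 < z.re) :
    DominatesReflection (C a + C b * X + C c * X ^ 2) z := by
  have hev : ∀ w : ℂ, aeval w (C a + C b * X + C c * X ^ 2 : ℝ[X]) = a + b * w + c * w ^ 2 := by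
    intro w; simp
  have hN : 0 < z.re ^ 2 + z.im ^ 2 := by positivity
  have hne : (a : ℂ) + b * z + c * z ^ 2 ≠ 0 := by
    intro h
    have hre := congrArg Complex.re h
    have him := congrArg Complex.im h
    simp [pow_two] at hre him
    -- This is the real part of `conj z` times the quadratic at `z`; each summand is nonnegative.
    have : a * z.re + b * (z.re ^ 2 + z.im ^ 2) + c * z.re * (z.re ^ 2 + z.im ^ 2) = 0 := by
      linear_combination z.re * hre + z.im * him
    have h1 : 0 ≤ a * z.re := by positivity
    have h2 : 0 ≤ b * (z.re ^ 2 + z.im ^ 2) := by positivity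
    have h3 : 0 ≤ c * z.re * (z.re ^ 2 + z.im ^ 2) := by positivity
    have e1 : a * z.re = 0 := by linarith
    have e2 : b * (z.re ^ 2 + z.im ^ 2) = 0 := by linarith
    have e3 : c * z.re * (z.re ^ 2 + z.im ^ 2) = 0 := by linarith
    simp only [mul_eq_zero, hz.ne', hN.ne', or_false] at e1 e2 e3
    linarith
  refine ⟨by rwa [hev], ?_⟩
  rcases hb.eq_or_lt with rfl | hb
  · exact Or.inr ⟨1, Or.inl rfl, fun w => by rw [hev, hev]; push_cast; ring⟩
  · rcases (add_nonneg ha hc).eq_or_lt with h | h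
    · have ha0 : a = 0 := by linarith
      have hc0 : c = 0 := by linarith
      subst ha0 hc0
      exact Or.inr ⟨-1, Or.inr rfl, fun w => by rw [hev, hev]; push_cast; ring⟩
    · left
      rw [← sq_lt_sq₀ (norm_nonneg _) (norm_nonneg _), hev, hev, ← Complex.normSq_eq_norm_sq,
        ← Complex.normSq_eq_norm_sq, Complex.normSq_apply, Complex.normSq_apply]
      simp [pow_two]
      -- Four times this quantity is `|f(z)|² - |f(-z)|²`.
      have key : 0 < b * z.re * (a + c * (z.re ^ 2 + z.im ^ 2)) := by
        refine mul_pos (mul_pos hb hz) ?_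
        rcases ha.eq_or_lt with rfl | ha
        · have : 0 < c := by linarith
          positivity
        · positivity
      nlinarith

lemma dominatesReflection_prod {ι : Type*} (s : Finset ι) {f : ι → ℝ[X]} {z : ℂ}
    (h : ∀ i ∈ s, DominatesReflection (f i) z) : DominatesReflection (∏ i ∈ s, f i) z :=
  Finset.prod_induction f (DominatesReflection · z) (fun _ _ => .mul) (dominatesReflection_one z) h

lemma expand_contract_add (f : ℝ[X]) :
    expand ℝ 2 (contract 2 f) + X * expand ℝ 2 (contract 2 (divX f)) = f := by
  ext k
  rcases Nat.even_or_odd' k with ⟨m, rfl | rfl⟩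
  · rw [coeff_add, coeff_expand_mul' two_pos, coeff_contract two_ne_zero]
    rcases m with _ | m
    · simp
    · rw [show 2 * (m + 1) = (2 * m + 1) + 1 by ring, coeff_X_mul, coeff_expand two_pos,
        if_neg (by omega), add_zero]
      congr 1; ring
  · rw [coeff_add, coeff_X_mul, coeff_expand_mul' two_pos, coeff_contract two_ne_zero, coeff_divX,
      coeff_expand two_pos, if_neg (by omega), zero_add, mul_comm]

lemma aeval_eq_even_add_odd (f : ℝ[X]) (z : ℂ) :
    aeval z f = aeval (z ^ 2) (contract 2 f) + z * aeval (z ^ 2) (contract 2 (divX f)) := by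
  conv_lhs => rw [← expand_contract_add f]
  simp [expand_aeval]

lemma exists_sq_eq_of_not_nonpos {y : ℂ} (hy : ¬(y.re ≤ 0 ∧ y.im = 0)) :
    ∃ z : ℂ, z ^ 2 = y ∧ 0 < z.re := by
  obtain ⟨z, hz⟩ := IsAlgClosed.exists_pow_nat_eq y (n := 2) two_pos
  rcases lt_trichotomy z.re 0 with h | h | h
  · exact ⟨-z, by rw [neg_sq, hz], by simpa using h⟩
  · refine absurd ?_ hy
    rw [← hz]
    simp [pow_two, h, mul_self_nonneg]
  · exact ⟨z, hz, h⟩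

/-- Only `w ≠ 0` is required, since for the odd part a factor `w` must be cancelled first. -/
lemma eq_zero_of_forall_aeval_sq {g : ℝ[X]} (h : ∀ w : ℂ, w ≠ 0 → aeval (w ^ 2) g = 0) :
    g = 0 := by
  refine Polynomial.eq_zero_of_infinite_isRoot g ((Set.Ioi_infinite (0 : ℝ)).mono fun x hx => ?_)
  have hx0 : (0 : ℝ) < x := hx
  have := h (Real.sqrt x : ℂ) (by exact_mod_cast (Real.sqrt_pos.2 hx0).ne')
  rw [← Complex.ofReal_pow, Real.sq_sqrt hx0.le] at this
  have e : aeval ((x : ℝ) : ℂ) g = ((g.eval x : ℝ) : ℂ) := by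
    simpa using aeval_algebraMap_apply ℂ x g
  rw [e] at this
  exact_mod_cast this

/-- Hermite-Biehler, even part: its roots are real and nonpositive. -/
lemma root_contract_nonpos {f : ℝ[X]} (hf : ∀ z : ℂ, 0 < z.re → DominatesReflection f z)
    (h0 : contract 2 f ≠ 0) {y : ℂ} (hy : aeval y (contract 2 f) = 0) : y.re ≤ 0 ∧ y.im = 0 := by
  by_contra hcon
  obtain ⟨z, rfl, hz⟩ := exists_sq_eq_of_not_nonpos hcon
  have e1 := aeval_eq_even_add_odd f z
  have e2 := aeval_eq_even_add_odd f (-z)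
  rw [neg_sq] at e2
  rw [hy] at e1 e2
  have e3 : aeval (-z) f = -aeval z f := by rw [e1, e2]; ring
  obtain ⟨hne, hlt | ⟨e, rfl | rfl, he⟩⟩ := hf z hz
  · rw [e3, norm_neg] at hlt
    exact lt_irrefl _ hlt
  · have := he z
    rw [e3, one_mul, neg_eq_iff_add_eq_zero, ← two_mul] at this
    exact hne (by simpa using this)
  -- If `f` is odd, its even part vanishes identically, contrary to `h0`.
  · refine h0 (eq_zero_of_forall_aeval_sq fun w _ => ?_)
    have := he w
    rw [aeval_eq_even_add_odd f w, aeval_eq_even_add_odd f (-w), neg_sq] at this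
    linear_combination this / 2

/-- Hermite-Biehler, odd part: its roots are real and nonpositive. -/
lemma root_contract_divX_nonpos {f : ℝ[X]} (hf : ∀ z : ℂ, 0 < z.re → DominatesReflection f z)
    (h0 : contract 2 (divX f) ≠ 0) {y : ℂ} (hy : aeval y (contract 2 (divX f)) = 0) :
    y.re ≤ 0 ∧ y.im = 0 := by
  by_contra hcon
  obtain ⟨z, rfl, hz⟩ := exists_sq_eq_of_not_nonpos hcon
  have e1 := aeval_eq_even_add_odd f z
  have e2 := aeval_eq_even_add_odd f (-z)
  rw [neg_sq] at e2
  rw [hy] at e1 e2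
  have e3 : aeval (-z) f = aeval z f := by rw [e1, e2]; ring
  obtain ⟨hne, hlt | ⟨e, rfl | rfl, he⟩⟩ := hf z hz
  · rw [e3] at hlt
    exact lt_irrefl _ hlt
  · refine h0 (eq_zero_of_forall_aeval_sq fun w hw => ?_)
    have := he w
    rw [aeval_eq_even_add_odd f w, aeval_eq_even_add_odd f (-w), neg_sq] at this
    have h2 : w * aeval (w ^ 2) (contract 2 (divX f)) = 0 := by linear_combination -this / 2
    exact (mul_eq_zero.1 h2).resolve_left hw
  · have := he z
    rw [e3, neg_one_mul, eq_neg_iff_add_eq_zero, ← two_mul] at this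
    exact hne (by simpa using this)

/-- A real polynomial with only real nonpositive roots is, up to a constant, the generating
function of a sum of independent Bernoulli variables. -/
lemma exists_eq_poissonBinomialPoly (n : ℕ) (P : ℝ[X]) (hP : P ≠ 0) (hdeg : P.natDegree ≤ n)
    (hroot : ∀ y : ℂ, aeval y P = 0 → y.re ≤ 0 ∧ y.im = 0) :
    ∃ (c : ℝ) (s : Multiset ℝ), Multiset.card s = n ∧ (∀ p ∈ s, 0 ≤ p ∧ p ≤ 1) ∧
      P = C c * poissonBinomialPoly s := by
  induction n generalizing P with
  | zero =>
    exact ⟨P.coeff 0, 0, rfl, by simp, by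
      rw [poissonBinomialPoly_zero, mul_one]; exact eq_C_of_natDegree_le_zero hdeg⟩
  | succ n ih =>
    by_cases h0 : P.natDegree ≤ n
    · obtain ⟨c, s, hs, h01, h⟩ := ih P hP h0 hroot
      -- A missing degree is filled by a Bernoulli variable with parameter `0`, whose factor is `1`.
      refine ⟨c, 0 ::ₘ s, by simp [hs], ?_, ?_⟩
      · intro p hp
        rcases Multiset.mem_cons.1 hp with rfl | hp
        · norm_num
        · exact h01 p hp
      · rw [poissonBinomialPoly_cons, h]
        simp [bernoulliPoly]
    · have hd : P.natDegree = n + 1 := by omega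
      obtain ⟨y, hy⟩ := IsAlgClosed.exists_aeval_eq_zero ℂ P (by
        rw [degree_eq_natDegree hP, hd]; exact_mod_cast Nat.succ_ne_zero n)
      obtain ⟨hre, him⟩ := hroot y hy
      obtain ⟨r, rfl⟩ : ∃ r : ℝ, y = (r : ℂ) := ⟨y.re, Complex.ext rfl (by simpa using him)⟩
      rw [Complex.ofReal_re] at hre
      have e : aeval ((r : ℝ) : ℂ) P = ((P.eval r : ℝ) : ℂ) := by
        simpa using aeval_algebraMap_apply ℂ r P
      rw [e] at hy
      have hr : P.IsRoot r := by exact_mod_cast hy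
      obtain ⟨Q, rfl⟩ := dvd_iff_isRoot.2 hr
      have hQ : Q ≠ 0 := right_ne_zero_of_mul hP
      rw [natDegree_mul (X_sub_C_ne_zero r) hQ, natDegree_X_sub_C] at hd
      obtain ⟨c, s, hs, h01, h⟩ := ih Q hQ (by omega) fun y hy => hroot y (by rw [map_mul, hy, mul_zero])
      have h1 : 0 < 1 - r := by linarith
      -- With `p = 1 / (1 - r)`, `X - r = (1 - r) ((1 - p) + p X)`, and `r ≤ 0` puts `p` in `(0,
      -- 1]`.
      refine ⟨c * (1 - r), (1 / (1 - r)) ::ₘ s, by simp [hs], ?_, ?_⟩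
      · intro p hp
        rcases Multiset.mem_cons.1 hp with rfl | hp
        · exact ⟨by positivity, by rw [div_le_one h1]; linarith⟩
        · exact h01 p hp
      · have hfac : (X - C r : ℝ[X]) = C (1 - r) * bernoulliPoly (1 / (1 - r)) := by
          rw [bernoulliPoly, mul_add, ← mul_assoc, ← C_mul, ← C_mul, mul_one_div_cancel h1.ne',
            show (1 - r) * (1 - 1 / (1 - r)) = -r by field_simp; ring, C_1, C_neg]
          ring
        rw [poissonBinomialPoly_cons, h, hfac, C_mul]
        ring

/-- If all roots of `P ≠ 0` are real and nonpositive, the normalised coefficients of `P` form a law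
on `{0, …, n}` of entropy at most that of `Bin(n, 1/2)`. -/
lemma coeffEntropy_normalized_le {n : ℕ} {P : ℝ[X]} {w : ℝ} (hP : P ≠ 0) (hdeg : P.natDegree ≤ n)
    (hroot : ∀ y : ℂ, aeval y P = 0 → y.re ≤ 0 ∧ y.im = 0)
    (hw : ∑ k ∈ range (n + 1), P.coeff k = w) :
    coeffEntropy n (C w⁻¹ * P) ≤ coeffEntropy n (bernoulliPoly (1 / 2) ^ n) := by
  obtain ⟨c, s, hs, h01, rfl⟩ := exists_eq_poissonBinomialPoly n P hP hdeg hroot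
  simp only [coeff_C_mul] at hw
  -- The Bernoulli product has mass `1`, so `c` is exactly the normalising constant `w`.
  rw [← mul_sum, sum_coeff_poissonBinomialPoly hs, mul_one] at hw
  subst hw
  have hc : c ≠ 0 := fun h => hP (by simp [h])
  rw [← mul_assoc, ← C_mul, inv_mul_cancel₀ hc, C_1, one_mul]
  exact coeffEntropy_poissonBinomialPoly_le hs h01

end HermiteBiehler

/-! ### From random variables to generating functions. -/

section SumLaw

open Polynomial Finset

lemma measureReal_add_eq_sum {Ω : Type*} [MeasurableSpace Ω] {μ : Measure Ω}
    [IsProbabilityMeasure μ] {S T : Ω → ℕ} (hS : Measurable S) (hT : Measurable T)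
    (h : IndepFun S T μ) (k : ℕ) :
    μ.real ((S + T) ⁻¹' {k}) =
      ∑ x ∈ antidiagonal k, μ.real (S ⁻¹' {x.1}) * μ.real (T ⁻¹' {x.2}) := by
  have hU : (S + T) ⁻¹' {k} = ⋃ x ∈ antidiagonal k, S ⁻¹' {x.1} ∩ T ⁻¹' {x.2} := by
    ext ω
    simp
  rw [hU, measureReal_biUnion_finset]
  · refine sum_congr rfl fun x _ => ?_
    simp only [measureReal_def]
    rw [h.measure_inter_preimage_eq_mul _ _ (measurableSet_singleton _) (measurableSet_singleton _),
      ENNReal.toReal_mul]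
  · intro x _ y _ hxy
    refine Set.disjoint_left.2 fun ω hω hω' => hxy ?_
    simp only [Set.mem_inter_iff, Set.mem_preimage, Set.mem_singleton_iff] at hω hω'
    exact Prod.ext (hω.1.symm.trans hω'.1) (hω.2.symm.trans hω'.2)
  · exact fun x _ => (hS (measurableSet_singleton _)).inter (hT (measurableSet_singleton _))

/-- The generating function of a variable with values in `{0, 1, 2}`. -/
noncomputable def quadraticPGF {Ω : Type*} [MeasurableSpace Ω] (μ : Measure Ω) (Y : Ω → ℕ) : ℝ[X] :=
  C (μ.real (Y ⁻¹' {0})) + C (μ.real (Y ⁻¹' {1})) * X + C (μ.real (Y ⁻¹' {2})) * X ^ 2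

section

variable {Ω : Type*} [MeasurableSpace Ω] {μ : Measure Ω}

lemma coeff_quadraticPGF {Y : Ω → ℕ} (hY : ∀ ω, Y ω ∈ ({0, 1, 2} : Set ℕ)) (k : ℕ) :
    (quadraticPGF μ Y).coeff k = μ.real (Y ⁻¹' {k}) := by
  rcases k with _ | _ | _ | k
  · simp [quadraticPGF]
  · simp [quadraticPGF, coeff_C, coeff_X_pow]
  · simp [quadraticPGF]
  · have : Y ⁻¹' {k + 1 + 1 + 1} = ∅ := by
      ext ω
      have := hY ω
      simp only [Set.mem_insert_iff, Set.mem_singleton_iff] at this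
      simp only [Set.mem_preimage, Set.mem_singleton_iff, Set.mem_empty_iff_false, iff_false]
      omega
    rw [this]
    simp [quadraticPGF]

lemma natDegree_quadraticPGF_le (Y : Ω → ℕ) : (quadraticPGF μ Y).natDegree ≤ 2 := by
  unfold quadraticPGF; compute_degree

variable [IsProbabilityMeasure μ]

lemma dominatesReflection_quadraticPGF {Y : Ω → ℕ} (hm : Measurable Y)
    (hY : ∀ ω, Y ω ∈ ({0, 1, 2} : Set ℕ)) {z : ℂ} (hz : 0 < z.re) :
    DominatesReflection (quadraticPGF μ Y) z := by
  refine dominatesReflection_quadratic measureReal_nonneg measureReal_nonneg measureReal_nonneg ?_ hz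
  have hU : (Set.univ : Set Ω) = ⋃ k ∈ range 3, Y ⁻¹' {k} := by
    ext ω
    have := hY ω
    simp only [Set.mem_insert_iff, Set.mem_singleton_iff] at this
    simp only [Set.mem_univ, Set.mem_iUnion, mem_range, Set.mem_preimage, Set.mem_singleton_iff,
      exists_prop, exists_eq_right', true_iff]
    omega
  have h : μ.real Set.univ = 1 := by simp
  rw [hU, measureReal_biUnion_finset
    (fun i _ j _ hij => (Set.disjoint_singleton.2 hij).preimage _)
    (fun k _ => hm (measurableSet_singleton k))] at h
  simp only [sum_range_succ, sum_range_zero, zero_add] at h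
  rw [h]
  exact one_pos

lemma coeff_prod_quadraticPGF {ι : Type*} (X : ι → Ω → ℕ) (hmeas : ∀ i, Measurable (X i))
    (hval : ∀ i ω, X i ω ∈ ({0, 1, 2} : Set ℕ)) (hindep : iIndepFun X μ) (s : Finset ι) (k : ℕ) :
    (∏ i ∈ s, quadraticPGF μ (X i)).coeff k = μ.real ((∑ i ∈ s, X i) ⁻¹' {k}) := by
  classical
  induction s using Finset.induction_on generalizing k with
  | empty =>
    rcases k with _ | k
    · have : ((0 : Ω → ℕ) ⁻¹' {0}) = Set.univ := by ext ω; simp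
      simp [this]
    · have : ((0 : Ω → ℕ) ⁻¹' {k + 1}) = ∅ := by ext ω; simp
      simp [this, coeff_one]
  | insert i s hi ih =>
    rw [prod_insert hi, sum_insert hi, coeff_mul, measureReal_add_eq_sum (hmeas i)
      (by simpa only [← Finset.sum_fn] using Finset.measurable_fun_sum s fun j _ => hmeas j)
      (hindep.indepFun_finsetSum_of_notMem hmeas hi).symm]
    simp only [coeff_quadraticPGF (hval i), ih]

lemma lawEntropy_eq_coeffEntropy_div {ν : Measure ℕ} {n : ℕ} {Q : ℝ[X]}
    (h : ∀ k, ν.real {k} = Q.coeff k) (hd : Q.natDegree ≤ n) :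
    lawEntropy ν = coeffEntropy n Q / Real.log 2 := by
  rw [lawEntropy, tsum_eq_sum (s := range (n + 1)), ← sum_neg_distrib, coeffEntropy, sum_div]
  · refine sum_congr rfl fun k _ => ?_
    rw [h, Real.negMulLog, Real.logb]
    ring
  · intro k hk
    rw [h, coeff_eq_zero_of_natDegree_lt (by rw [mem_range] at hk; omega), zero_mul]

lemma binomialHalfEntropy_eq (n : ℕ) :
    binomialHalfEntropy n = coeffEntropy n (bernoulliPoly (1 / 2) ^ n) / Real.log 2 :=
  lawEntropy_eq_coeffEntropy_div
    (fun k => by rw [binomial_real_singleton, coeff_bernoulliPoly_pow])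
    (Nat.le_of_lt_succ (natDegree_bernoulliPoly_pow_lt _ n))

/-- If the joint law of `K` and `J = j` is given by the coefficients of a polynomial with real
nonpositive roots, then `H(K ∣ J = j)` is at most the entropy of a symmetric binomial law. -/
lemma entropyGivenEq_le {K J : Ω → ℕ} (hK : Measurable K) (hJ : Measurable J) {j n : ℕ} {P : ℝ[X]}
    (hP : ∀ k, P.coeff k = μ.real (J ⁻¹' {j} ∩ K ⁻¹' {k})) (hdeg : P.natDegree ≤ n)
    (hroot : P ≠ 0 → ∀ y : ℂ, aeval y P = 0 → y.re ≤ 0 ∧ y.im = 0)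
    (hpos : 0 < μ.real (J ⁻¹' {j})) (hKn : ∀ ω, J ω = j → K ω ≤ n) :
    entropyGivenEq μ K J j ≤ binomialHalfEntropy n := by
  have hE : MeasurableSet (J ⁻¹' {j}) := hJ (measurableSet_singleton j)
  have hsum : ∑ k ∈ range (n + 1), P.coeff k = μ.real (J ⁻¹' {j}) := by
    have hU : J ⁻¹' {j} = ⋃ k ∈ range (n + 1), J ⁻¹' {j} ∩ K ⁻¹' {k} := by
      ext ω
      have := hKn ω
      simp only [Set.mem_preimage, Set.mem_singleton_iff, Set.mem_iUnion, Set.mem_inter_iff,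
        mem_range, exists_prop]
      exact ⟨fun h => ⟨K ω, Nat.lt_succ_of_le (this h), h, rfl⟩, fun ⟨_, _, h, _⟩ => h⟩
    conv_rhs => rw [hU]
    rw [measureReal_biUnion_finset]
    · exact sum_congr rfl fun k _ => hP k
    · exact fun a _ b _ hab => ((Set.disjoint_singleton.2 hab).preimage K).mono
        Set.inter_subset_right Set.inter_subset_right
    · exact fun k _ => hE.inter (hK (measurableSet_singleton k))
  have hP0 : P ≠ 0 := by
    rintro rfl
    simp at hsum
    linarith
  rw [entropyGivenEq, shannonEntropy, lawEntropy_eq_coeffEntropy_div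
    (Q := C (μ.real (J ⁻¹' {j}))⁻¹ * P) (n := n), binomialHalfEntropy_eq]
  · exact div_le_div_of_nonneg_right (coeffEntropy_normalized_le hP0 hdeg (hroot hP0) hsum)
      (Real.log_nonneg one_le_two)
  · intro k
    rw [map_measureReal_apply hK (measurableSet_singleton k), measureReal_def, cond_apply hE, ENNReal.toReal_mul,
      ENNReal.toReal_inv, coeff_C_mul, hP, measureReal_def, measureReal_def]
  · exact (natDegree_C_mul_le _ _).trans hdeg

end

end SumLaw

/-! ### The entropy bounds. -/

theorem corollary2 {Ω : Type*} [MeasurableSpace Ω] (μ : Measure Ω) [IsProbabilityMeasure μ]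
    (n : ℕ) (hn : 1 ≤ n) (X : Fin n → Ω → ℕ)
    (hmeas : ∀ i, Measurable (X i))
    (hval : ∀ i ω, X i ω ∈ ({0, 1, 2} : Set ℕ))
    (hindep : iIndepFun X μ) :
    (0 < μ.real (parityVar X ⁻¹' {0}) →
      entropyGivenEq μ (halfVar X) (parityVar X) 0 ≤ binomialHalfEntropy n) ∧
    (0 < μ.real (parityVar X ⁻¹' {1}) →
      entropyGivenEq μ (halfVar X) (parityVar X) 1 ≤ binomialHalfEntropy (n - 1)) ∧
    condShannonEntropy μ (halfVar X) (parityVar X) ≤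
      μ.real (parityVar X ⁻¹' {0}) * binomialHalfEntropy n +
        μ.real (parityVar X ⁻¹' {1}) * binomialHalfEntropy (n - 1) := by
  have hS : Measurable (sumVar X) := Finset.measurable_fun_sum _ fun i _ => hmeas i
  have hJ : Measurable (parityVar X) := (measurable_of_countable fun k : ℕ => k % 2).comp hS
  have hK : Measurable (halfVar X) :=
    (measurable_of_countable fun k : ℕ => (k - k % 2) / 2).comp hS
  have hle : ∀ ω, sumVar X ω ≤ 2 * n := fun ω => by
    have h : ∀ i ∈ Finset.univ, X i ω ≤ 2 := fun i _ => by
      have := hval i ω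
      simp only [Set.mem_insert_iff, Set.mem_singleton_iff] at this
      omega
    have := Finset.sum_le_card_nsmul _ _ _ h
    simpa [sumVar, mul_comm] using this
  set f : Polynomial ℝ := ∏ i, quadraticPGF μ (X i) with hf
  have hcoeff : ∀ k, f.coeff k = μ.real (sumVar X ⁻¹' {k}) := fun k => by
    rw [hf, coeff_prod_quadraticPGF X hmeas hval hindep]
    congr 2
    ext ω
    simp [sumVar]
  have hdeg : f.natDegree ≤ 2 * n := by
    refine (Polynomial.natDegree_prod_le _ _).trans ?_
    have := Finset.sum_le_card_nsmul Finset.univ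
      (fun i => (quadraticPGF μ (X i)).natDegree) 2 fun i _ => natDegree_quadraticPGF_le (X i)
    simpa [mul_comm] using this
  have hdom : ∀ z : ℂ, 0 < z.re → DominatesReflection f z := fun z hz =>
    dominatesReflection_prod _ fun i _ => dominatesReflection_quadraticPGF (hmeas i) (hval i) hz
  have h0 : 0 < μ.real (parityVar X ⁻¹' {0}) →
      entropyGivenEq μ (halfVar X) (parityVar X) 0 ≤ binomialHalfEntropy n := by
    intro hpos
    refine entropyGivenEq_le hK hJ (P := f.contract 2) (fun k => ?_) ?_
      (fun h y hy => root_contract_nonpos hdom h hy) hpos fun ω _ => ?_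
    · rw [Polynomial.coeff_contract two_ne_zero, hcoeff]
      congr 1
      ext ω
      simp only [Set.mem_preimage, Set.mem_inter_iff, Set.mem_singleton_iff, parityVar, halfVar]
      omega
    · refine Polynomial.natDegree_le_iff_coeff_eq_zero.2 fun k hk => ?_
      rw [Polynomial.coeff_contract two_ne_zero]
      exact Polynomial.coeff_eq_zero_of_natDegree_lt (by omega)
    · have := hle ω
      simp only [halfVar, parityVar]
      omega
  have h1 : 0 < μ.real (parityVar X ⁻¹' {1}) →
      entropyGivenEq μ (halfVar X) (parityVar X) 1 ≤ binomialHalfEntropy (n - 1) := by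
    intro hpos
    refine entropyGivenEq_le hK hJ (P := f.divX.contract 2) (fun k => ?_) ?_
      (fun h y hy => root_contract_divX_nonpos hdom h hy) hpos fun ω hω => ?_
    · rw [Polynomial.coeff_contract two_ne_zero, Polynomial.coeff_divX, hcoeff]
      congr 1
      ext ω
      simp only [Set.mem_preimage, Set.mem_inter_iff, Set.mem_singleton_iff, parityVar, halfVar]
      omega
    -- If `k > n - 1` then `2k + 1 > 2n`: the odd part loses one degree, whence `n - 1`.
    · refine Polynomial.natDegree_le_iff_coeff_eq_zero.2 fun k hk => ?_
      rw [Polynomial.coeff_contract two_ne_zero, Polynomial.coeff_divX]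
      exact Polynomial.coeff_eq_zero_of_natDegree_lt (by omega)
    · have := hle ω
      simp only [halfVar, parityVar] at hω ⊢
      omega
  -- A parity class of probability zero has no entropy bound, but its weight removes the term.
  have hmul : ∀ {w a b : ℝ}, 0 ≤ w → (0 < w → a ≤ b) → w * a ≤ w * b := by
    intro w a b hw h
    rcases hw.eq_or_lt with rfl | hw
    · simp
    · exact mul_le_mul_of_nonneg_left (h hw) hw.le
  refine ⟨h0, h1, ?_⟩
  rw [condShannonEntropy, tsum_eq_sum (s := Finset.range 2)]
  · simp only [Finset.sum_range_succ, Finset.sum_range_zero, zero_add]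
    exact add_le_add (hmul measureReal_nonneg h0) (hmul measureReal_nonneg h1)
  · intro y hy
    have : parityVar X ⁻¹' {y} = ∅ := by
      ext ω
      simp only [Finset.mem_range, not_lt] at hy
      simp only [Set.mem_preimage, Set.mem_singleton_iff, Set.mem_empty_iff_false, iff_false,
        parityVar]
      omega
    rw [this]
    simp
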